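/- **Setting.** Let $\Sigma$ be a first-order signature consisting of relation symbols only (of arbitrary finite arities, without equality as a logical symbol). Formulas $\Phi(x_0,\dots,x_{n-1})$ are built from atomic formulas and $\bot$ with $\to,\wedge,\vee,\forall,\exists$, with $\neg\Phi:=\Phi\to\bot$; each formula carries the list $x_0,\dots,x_{n-1}$ of its free variables and quantifiers bind the last variable of the list. $\Gamma\vdash\Phi$ denotes derivability in natural deduction for classical first-order logic (with non-empty domains). *Indefinitely large sets.* Let $\mathcal I$ be a non-empty directed preorder. Lists $C\in\mathcal I^n$ are called contexts, $Ci$ is $C$ with $i$ appended, and $\uparrow i=\{i'\mid i'\ge i\}$. Define $\mathfrak D_0=\{\{()\}\}$, and for $\mathcal H\subseteq\mathcal I^{n+1}$ let $\mathcal H\in\mathfrak D_{n+1}$ iff the set of all $C\in\mathcal I^n$ with $\uparrow i_0\subseteq\{i\mid Ci\in\mathcal H\}$ for some $i_0$ is in $\mathfrak D_n$. *Structures.* An indefinitely extensible structure $\mathcal M_{\mathcal I}$ consists of finite sets $\mathcal M_i$ ($i\in\mathcal I$), not all empty, with $\mathcal M_i\subseteq\mathcal M_{i'}$ for $i\le i'$;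 of a refined signature, that is, a set of assignments $R:C$ for relation symbols $R$ and $C\in\mathcal I^{\mathrm{arity}(R)}$ such that $\{C\mid R:C\}\in\mathfrak D_{\mathrm{arity}(R)}$ for each $R$ (it is *full* if it contains all $R:C$); and of relations $R_C\subseteq\mathcal M_C:=\prod_k\mathcal M_{i_k}$ for each $R:C$, such that $R_C(a)\iff R_{C'}(a)$ for $a\in\mathcal M_C\cap\mathcal M_{C'}$. *Models.* A $\ll$-relation is a family of sets $\ll_n\subseteq\mathcal I^n$, $n\in\mathbb N$, such that $Ci\in\ll_{n+1}$ (written $C\ll i$) implies $C\in\ll_n$; it is *indefinitely large* if $\ll_n\in\mathfrak D_n$ for all $n$. The *state declarations* $C:\Phi$, for $C=(i_0,\dots,i_{n-1})\in\ll_n$, are defined by recursion: $C:\bot$ always; $C:R\,x_{k_1}\dots x_{k_m}$ iff there is an assignment $R:(j_1,\dots,j_m)$ with $j_l\ge i_{k_l}$ for all $l$; for $\to,\wedge,\vee$ both parts must be declared in $C$; $C:\forall x\,\Psi$ and $C:\exists x\,\Psi$ hold iff $Ci:\Psi$ for some $i$ with $C\ll i$. For $C:\Phi$ and $a\in\mathcal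 M_C$ the interpretation $\models_\ll\Phi[a:C]$ is defined by: $\models_\ll R\,x_{k_1}\dots x_{k_m}[a:C]$ iff $R_J(a_{k_1},\dots,a_{k_m})$ for some assignment $R:J$ with $J=(j_1,\dots,j_m)$, $j_l\ge i_{k_l}$; $\bot,\to,\wedge,\vee$ as usual; $\models_\ll\forall x\,\Psi[a:C]$ iff for some $i\gg C$ with $Ci:\Psi$ we have $\models_\ll\Psi[ab:Ci]$ for all $b\in\mathcal M_i$; $\models_\ll\exists x\,\Psi[a:C]$ iff for all $i\gg C$ with $Ci:\Psi$ we have $\models_\ll\Psi[ab:Ci]$ for some $b\in\mathcal M_i$. The pair $(\mathcal M_{\mathcal I},\models_\ll)$ is called an indefinitely extensible model; let $\mathfrak M^{ind}$ be the collection of all of them, where $\mathcal I$, $\mathcal M_{\mathcal I}$ and $\ll$ all vary. *Adequacy.* Let $\models_m$ be the interpretation in which $\forall x\,\Psi[a:C]$ means $\Psi[ab:Ci]$ for all $i\in\mathcal I$ and all $b\in\mathcal M_i$, and $\exists x\,\Psi[a:C]$ means $\Psi[ab:Ci]$ for some $i\in\mathcal I$ and some $b\in\mathcal M_i$ (the other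 clauses as for $\models_\ll$). For $\Psi(x_0,\dots,x_n)$ let $\ll_\Psi$ be the family generated by the set of all $Ci\in\mathcal I^{n+1}$ such that for every $a\in\mathcal M_C$: if some $\mathcal M_j$ contains a $b$ with $\models_m\Psi[ab:Cj]$, then $\mathcal M_i$ contains a $b$ with $\models_m\Psi[ab:Ci]$. (The family generated by $\mathcal H\subseteq\mathcal I^{n+1}$ consists of the contexts of length at most $n+1$ that can be extended to an element of $\mathcal H$ and of the longer contexts whose initial segment of length $n+1$ is in $\mathcal H$.) A $\ll$-relation is adequate for a set $\mathcal T$ of sentences if it is contained in $\ll_\Psi$ for all $\exists x\,\Psi\in\hat{\mathcal T}$, where $\hat{\mathcal T}$ arises from $\mathcal T$ by replacing each $\forall x$ by $\neg\exists x\neg$ and then adding all subformulas. A model is called a *model for* $\mathcal T$ if its relation $\ll$ is adequate for $\mathcal T$ and $():\Phi$ for all $\Phi\in\mathcal T$. **Statement.** Let $\mathfrak K=\mathfrak M^{ind}$ or, more generally, let $\mathfrak K\subseteq\mathfrak M^{ind}$ be any subclass that contains all models with full refined signature and indefinitely large $\ll$-relation. For a set $\mathcal T$ of sentences write $\mathfrak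 K\models_\ll\mathcal T$ if $\models_\ll\Phi$ holds for all $\Phi\in\mathcal T$ in all models in $\mathfrak K$ for $\mathcal T$. For a set $\Gamma$ of sentences and a sentence $\Phi$ write $\Gamma\models_{\mathfrak K}\Phi$ if in every model in $\mathfrak K$ for $\Gamma\cup\{\Phi\}$ that satisfies all sentences in $\Gamma$ the sentence $\Phi$ is satisfied, too. Then the interpretation $\models_\ll$ is sound and complete with respect to $\mathfrak K$: 1. For every finite set $\mathcal T$ of sentences: $\vdash\Phi$ for all $\Phi\in\mathcal T$ if and only if $\mathfrak K\models_\ll\mathcal T$. 2. For every finite set $\Gamma$ of sentences and every sentence $\Phi$: $\Gamma\vdash\Phi$ if and only if $\Gamma\models_{\mathfrak K}\Phi$. 3. For every set $\Gamma$ of sentences and every sentence $\Phi$: $\Gamma\vdash\Phi$ if and only if $\Gamma_1\models_{\mathfrak K}\Phi$ for all sufficiently large finite $\Gamma_1\subseteq\Gamma$, that is, there is a finite $\Gamma_0\subseteq\Gamma$ such that $\Gamma_1\models_{\mathfrak K}\Phi$ for all finite $\Gamma_1$ with $\Gamma_0\subseteq\Gamma_1\subseteq\Gamma$. -/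

import Mathlib

universe u v w w'

namespace PotInf

/-! ### First-order formulas over a relational signature -/

/-- Formulas `Φ(x₀, …, xₙ₋₁)` over the relation symbols of `L`.  The type `Formula L n` contains the
formulas together with their list `x₀, …, xₙ₋₁` of (possibly) free variables; a quantifier binds the
last variable of the list.  There are no function symbols, so terms are variables, and there is no
logical equality (equality may be one of the relation symbols). -/
inductive Formula (L : FirstOrder.Language.{u, v}) : ℕ → Type v
  | bot {n : ℕ} : Formula L n
  | rel {n m : ℕ} (R : L.Relations m) (t : Fin m → Fin n) : Formula L n
  | imp {n : ℕ} (φ ψ : Formula L n) : Formula L n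
  | and {n : ℕ} (φ ψ : Formula L n) : Formula L n
  | or {n : ℕ} (φ ψ : Formula L n) : Formula L n
  | all {n : ℕ} (φ : Formula L (n + 1)) : Formula L n
  | ex {n : ℕ} (φ : Formula L (n + 1)) : Formula L n

/-- A sentence is a formula with the empty list of free variables. -/
abbrev Sentence (L : FirstOrder.Language.{u, v}) : Type v := Formula L 0

/-- `extend C i` is the list `C` with `i` added at its end. -/
abbrev extend {X : Type*} {n : ℕ} (C : Fin n → X) (i : X) : Fin (n + 1) → X :=
  Fin.snoc (α := fun _ => X) C i

namespace Formula

variable {L : FirstOrder.Language.{u, v}}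

/-- `¬ φ` abbreviates `φ → ⊥`. -/
def neg {n : ℕ} (φ : Formula L n) : Formula L n := imp φ bot

/-- Simultaneous (capture free) substitution of the variables `x_{f k}` for the free
variables `x_k`. -/
def subst : {n : ℕ} → Formula L n → {m : ℕ} → (Fin n → Fin m) → Formula L m
  | _, bot, _, _ => bot
  | _, rel R t, _, f => rel R (fun k => f (t k))
  | _, imp φ ψ, _, f => imp (φ.subst f) (ψ.subst f)
  | _, and φ ψ, _, f => and (φ.subst f) (ψ.subst f)
  | _, or φ ψ, _, f => or (φ.subst f) (ψ.subst f)
  | _, all φ, m, f => all (φ.subst (extend (fun k => (f k).castSucc) (Fin.last m)))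
  | _, ex φ, m, f => ex (φ.subst (extend (fun k => (f k).castSucc) (Fin.last m)))

/-- The formula `φ` with the additional variable `xₙ`, not occurring free, in its variable list. -/
def weaken {n : ℕ} (φ : Formula L n) : Formula L (n + 1) := φ.subst Fin.castSucc

/-- `φ.inst k` is `φ` with the variable `x_k` substituted for the last variable. -/
def inst {n : ℕ} (φ : Formula L (n + 1)) (k : Fin n) : Formula L n := φ.subst (extend id k)

/-- Replace each occurrence of `∀ x` by `¬ ∃ x ¬`. -/
def elimAll : {n : ℕ} → Formula L n → Formula L n
  | _, bot => bot
  | _, rel R t => rel R t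
  | _, imp φ ψ => imp φ.elimAll ψ.elimAll
  | _, and φ ψ => and φ.elimAll ψ.elimAll
  | _, or φ ψ => or φ.elimAll ψ.elimAll
  | _, all φ => neg (ex (neg φ.elimAll))
  | _, ex φ => ex φ.elimAll

/-- The set of all subformulas of a formula (including the formula itself). -/
def subformulas : {n : ℕ} → Formula L n → Set (Σ k : ℕ, Formula L k)
  | n, bot => {⟨n, bot⟩}
  | n, rel R t => {⟨n, rel R t⟩}
  | n, imp φ ψ => {⟨n, imp φ ψ⟩} ∪ (φ.subformulas ∪ ψ.subformulas)
  | n, and φ ψ => {⟨n, and φ ψ⟩} ∪ (φ.subformulas ∪ ψ.subformulas)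
  | n, or φ ψ => {⟨n, or φ ψ⟩} ∪ (φ.subformulas ∪ ψ.subformulas)
  | n, all φ => {⟨n, all φ⟩} ∪ φ.subformulas
  | n, ex φ => {⟨n, ex φ⟩} ∪ φ.subformulas

end Formula

/-- The set `T̂`: replace each `∀ x` in `T` by `¬ ∃ x ¬`, then add all subformulas. -/
def hat {L : FirstOrder.Language.{u, v}} (T : Set (Sentence L)) : Set (Σ k : ℕ, Formula L k) :=
  {χ | ∃ φ ∈ T, χ ∈ φ.elimAll.subformulas}

/-! ### A deductive system of classical first-order logic -/

/-- Natural deduction for classical first-order logic: `Derives Γ φ` says that `φ` is derivable from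
the assumptions `Γ`, where all formulas have the free variables `x₀, …, xₙ₋₁`. In the rules `all_intro`
and `ex_elim` the eigenvariable is the new variable `xₙ`. The axiom `ex_top`, which is `∃ x ⊤`, says that
the domain is non-empty; in systems in which an unlimited supply of free variables is always
available it is derivable. -/
inductive Derives {L : FirstOrder.Language.{u, v}} :
    {n : ℕ} → Set (Formula L n) → Formula L n → Prop
  | assumption {n : ℕ} {Γ : Set (Formula L n)} {φ : Formula L n} : φ ∈ Γ → Derives Γ φ
  | imp_intro {n : ℕ} {Γ : Set (Formula L n)} {φ ψ : Formula L n} :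
      Derives (insert φ Γ) ψ → Derives Γ (.imp φ ψ)
  | imp_elim {n : ℕ} {Γ : Set (Formula L n)} {φ ψ : Formula L n} :
      Derives Γ (.imp φ ψ) → Derives Γ φ → Derives Γ ψ
  | and_intro {n : ℕ} {Γ : Set (Formula L n)} {φ ψ : Formula L n} :
      Derives Γ φ → Derives Γ ψ → Derives Γ (.and φ ψ)
  | and_left {n : ℕ} {Γ : Set (Formula L n)} {φ ψ : Formula L n} :
      Derives Γ (.and φ ψ) → Derives Γ φ
  | and_right {n : ℕ} {Γ : Set (Formula L n)} {φ ψ : Formula L n} :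
      Derives Γ (.and φ ψ) → Derives Γ ψ
  | or_left {n : ℕ} {Γ : Set (Formula L n)} {φ ψ : Formula L n} :
      Derives Γ φ → Derives Γ (.or φ ψ)
  | or_right {n : ℕ} {Γ : Set (Formula L n)} {φ ψ : Formula L n} :
      Derives Γ ψ → Derives Γ (.or φ ψ)
  | or_elim {n : ℕ} {Γ : Set (Formula L n)} {φ ψ χ : Formula L n} :
      Derives Γ (.or φ ψ) → Derives (insert φ Γ) χ → Derives (insert ψ Γ) χ → Derives Γ χ
  | by_contra {n : ℕ} {Γ : Set (Formula L n)} {φ : Formula L n} :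
      Derives (insert φ.neg Γ) .bot → Derives Γ φ
  | all_intro {n : ℕ} {Γ : Set (Formula L n)} {φ : Formula L (n + 1)} :
      Derives (Formula.weaken '' Γ) φ → Derives Γ (.all φ)
  | all_elim {n : ℕ} {Γ : Set (Formula L n)} {φ : Formula L (n + 1)} (k : Fin n) :
      Derives Γ (.all φ) → Derives Γ (φ.inst k)
  | ex_intro {n : ℕ} {Γ : Set (Formula L n)} {φ : Formula L (n + 1)} (k : Fin n) :
      Derives Γ (φ.inst k) → Derives Γ (.ex φ)
  | ex_elim {n : ℕ} {Γ : Set (Formula L n)} {φ : Formula L (n + 1)} {χ : Formula L n} :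
      Derives Γ (.ex φ) → Derives (insert φ (Formula.weaken '' Γ)) χ.weaken → Derives Γ χ
  | ex_top {n : ℕ} {Γ : Set (Formula L n)} : Derives Γ (.ex (.neg .bot))

/-! ### Contexts and indefinitely large sets of contexts -/

section Contexts

variable {I : Type w} [Preorder I]

/-- The sets `𝔇ₙ` of subsets of `Iⁿ`: `𝔇₀` has the one element `{()}`, and `H ∈ 𝔇ₙ₊₁` iff the set of
all `C` such that `{i | Ci ∈ H}` includes some `↑i₀ = {i | i ≥ i₀}` is in `𝔇ₙ`. -/
def IsLarge : (n : ℕ) → Set (Fin n → I) → Prop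
  | 0, H => H = {![]}
  | n + 1, H => IsLarge n {C : Fin n → I | ∃ i₀ : I, ∀ i, i₀ ≤ i → extend C i ∈ H}

/-- The family generated by a set `H` of contexts of length `n`: a shorter context is in the family
iff it can be extended to an element of `H`; a longer context is in the family iff its initial
segment of length `n` is an element of `H`. -/
def generated {n : ℕ} (H : Set (Fin n → I)) (m : ℕ) : Set (Fin m → I) :=
  {C | ∃ D ∈ H, ∀ (k : ℕ) (hm : k < m) (hn : k < n), C ⟨k, hm⟩ = D ⟨k, hn⟩}

end Contexts

/-- A `≪`-relation on the index set `I`: a family of sets of contexts (the `≪`-contexts) that is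
closed under initial segments. `C ≪ i` means that `Ci` is a `≪`-context. -/
structure LLRelation (I : Type w) where
  ctx : (n : ℕ) → Set (Fin n → I)
  of_extend : ∀ {n : ℕ} (C : Fin n → I) (i : I), extend C i ∈ ctx (n + 1) → C ∈ ctx n

/-- A `≪`-relation is indefinitely large iff for each `n` its set of contexts of length `n` is in
`𝔇ₙ`. -/
def LLRelation.IsIndefinitelyLarge {I : Type w} [Preorder I] (ll : LLRelation I) : Prop :=
  ∀ n, IsLarge n (ll.ctx n)

/-! ### Indefinitely extensible structures -/

/-- An indefinitely extensible structure over the directed index set `I`: an increasing family of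
finite sets `Mᵢ` (subsets of an ambient type `A`), at least one of them non-empty, together with a
refined signature, consisting of assignments `R : C` for the relation symbols `R`, and, for each
assignment `R : C`, an instance `R_C ⊆ M_C`; the instances of `R` are compatible. The refined
signature is indefinitely large (by default it contains `R : C` for all `C`). -/
structure IndStructure (L : FirstOrder.Language.{u, v}) (I : Type w) [Preorder I]
    (A : Type w') where
  carrier : I → Set A
  carrier_finite : ∀ i, (carrier i).Finite
  carrier_mono : ∀ {i j : I}, i ≤ j → carrier i ⊆ carrier j
  carrier_nonempty : ∃ i, (carrier i).Nonempty
  sig : ∀ {n : ℕ}, L.Relations n → Set (Fin n → I)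
  sig_large : ∀ {n : ℕ} (R : L.Relations n), IsLarge n (sig R)
  rel : ∀ {n : ℕ}, L.Relations n → (Fin n → I) → Set (Fin n → A)
  rel_subset : ∀ {n : ℕ} (R : L.Relations n) (C : Fin n → I), C ∈ sig R →
    ∀ a ∈ rel R C, ∀ k, a k ∈ carrier (C k)
  rel_compatible : ∀ {n : ℕ} (R : L.Relations n) (C C' : Fin n → I), C ∈ sig R → C' ∈ sig R →
    ∀ a : Fin n → A, (∀ k, a k ∈ carrier (C k)) → (∀ k, a k ∈ carrier (C' k)) →
      (a ∈ rel R C ↔ a ∈ rel R C')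

namespace IndStructure

variable {L : FirstOrder.Language.{u, v}} {I : Type w} [Preorder I] {A : Type w'}

/-- `M_C = M_{i₀} × ⋯ × M_{iₙ₋₁}` for `C = (i₀, …, iₙ₋₁)`. -/
def prod (M : IndStructure L I A) {n : ℕ} (C : Fin n → I) : Set (Fin n → A) :=
  {a | ∀ k, a k ∈ M.carrier (C k)}

/-- The state declaration `C : φ`. The declaration `C : x_k : j` of a variable is `C k ≤ j`. -/
def Declared (M : IndStructure L I A) (ll : LLRelation I) :
    {n : ℕ} → Formula L n → (Fin n → I) → Prop
  | n, .bot, C => C ∈ ll.ctx n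
  | n, .rel R t, C => C ∈ ll.ctx n ∧ ∃ J ∈ M.sig R, ∀ k, C (t k) ≤ J k
  | _, .imp φ ψ, C => M.Declared ll φ C ∧ M.Declared ll ψ C
  | _, .and φ ψ, C => M.Declared ll φ C ∧ M.Declared ll ψ C
  | _, .or φ ψ, C => M.Declared ll φ C ∧ M.Declared ll ψ C
  | n, .all φ, C => ∃ i, extend C i ∈ ll.ctx (n + 1) ∧ M.Declared ll φ (extend C i)
  | n, .ex φ, C => ∃ i, extend C i ∈ ll.ctx (n + 1) ∧ M.Declared ll φ (extend C i)

/-- The interpretation `M ⊨_≪ φ [a : C]` with reflection principle. It is a relation between a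
declared formula `C : φ` and an assignment `a ∈ M_C`; accordingly the indices `i` in the clauses
for the quantifiers range over those `i ≫ C` for which the declaration `Ci : φ` holds. -/
def Sat (M : IndStructure L I A) (ll : LLRelation I) :
    {n : ℕ} → Formula L n → (Fin n → I) → (Fin n → A) → Prop
  | _, .bot, _, _ => False
  | _, .rel R t, C, a => ∃ J ∈ M.sig R, (∀ k, C (t k) ≤ J k) ∧ (fun k => a (t k)) ∈ M.rel R J
  | _, .imp φ ψ, C, a => M.Sat ll φ C a → M.Sat ll ψ C a
  | _, .and φ ψ, C, a => M.Sat ll φ C a ∧ M.Sat ll ψ C a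
  | _, .or φ ψ, C, a => M.Sat ll φ C a ∨ M.Sat ll ψ C a
  | n, .all φ, C, a => ∃ i, extend C i ∈ ll.ctx (n + 1) ∧ M.Declared ll φ (extend C i) ∧
      ∀ b ∈ M.carrier i, M.Sat ll φ (extend C i) (extend a b)
  | n, .ex φ, C, a => ∀ i, extend C i ∈ ll.ctx (n + 1) → M.Declared ll φ (extend C i) →
      ∃ b ∈ M.carrier i, M.Sat ll φ (extend C i) (extend a b)

/-- The auxiliary interpretation `M ⊨_m φ [a : C]`, in which the quantifiers range over all
elements of all stages. It uses the trivial `≪`-relation, for which every formula is declared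
in every context since the signature is indefinitely large. -/
def SatM (M : IndStructure L I A) :
    {n : ℕ} → Formula L n → (Fin n → I) → (Fin n → A) → Prop
  | _, .bot, _, _ => False
  | _, .rel R t, C, a => ∃ J ∈ M.sig R, (∀ k, C (t k) ≤ J k) ∧ (fun k => a (t k)) ∈ M.rel R J
  | _, .imp φ ψ, C, a => M.SatM φ C a → M.SatM ψ C a
  | _, .and φ ψ, C, a => M.SatM φ C a ∧ M.SatM ψ C a
  | _, .or φ ψ, C, a => M.SatM φ C a ∨ M.SatM ψ C a
  | _, .all φ, C, a => ∀ i, ∀ b ∈ M.carrier i, M.SatM φ (extend C i) (extend a b)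
  | _, .ex φ, C, a => ∃ i, ∃ b ∈ M.carrier i, M.SatM φ (extend C i) (extend a b)

/-- The set of indices `i` such that `Mᵢ` contains a witness `b` with `M ⊨_m ψ [ab : Ci]`, or the set
of all indices if there is no such index. -/
def witnessIndices (M : IndStructure L I A) {n : ℕ} (ψ : Formula L (n + 1)) (C : Fin n → I)
    (a : Fin n → A) : Set I :=
  {i | (∃ j, ∃ b ∈ M.carrier j, M.SatM ψ (extend C j) (extend a b)) →
    ∃ b ∈ M.carrier i, M.SatM ψ (extend C i) (extend a b)}

/-- The `≪`-relation (as a family of sets of contexts) given by the relation that the formula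
`ψ(x₀, …, xₙ)` defines: it is generated by the set of all `Ci` of length `n + 1` such that `i` is in
the set of witness indices for all `a ∈ M_C`. -/
def llOfFormula (M : IndStructure L I A) {n : ℕ} (ψ : Formula L (n + 1)) (m : ℕ) :
    Set (Fin m → I) :=
  generated {D : Fin (n + 1) → I |
    ∀ a ∈ M.prod (Fin.init D : Fin n → I), D (Fin.last n) ∈ M.witnessIndices ψ (Fin.init D) a} m

/-- The relation `≪_T`: the intersection of the relations given by all `ψ` with `∃ x ψ ∈ T̂`. -/
def llOfTheory (M : IndStructure L I A) (T : Set (Sentence L)) (m : ℕ) : Set (Fin m → I) :=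
  {C | ∀ (n : ℕ) (ψ : Formula L (n + 1)), (⟨n, .ex ψ⟩ : Σ k, Formula L k) ∈ hat T →
    C ∈ M.llOfFormula ψ m}

/-- A `≪`-relation is adequate for `T` iff it is a subset of `≪_T`. -/
def Adequate (M : IndStructure L I A) (ll : LLRelation I) (T : Set (Sentence L)) : Prop :=
  ∀ m, ll.ctx m ⊆ M.llOfTheory T m

end IndStructure

/-! ### Indefinitely extensible models -/

/-- An indefinitely extensible model `(M, ⊨_≪)`: a non-empty directed index set, an indefinitely
extensible structure over it, and a `≪`-relation, which determines the interpretation. -/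
structure IndModel (L : FirstOrder.Language.{u, v}) where
  Idx : Type w
  [preorder : Preorder Idx]
  [directed : IsDirectedOrder Idx]
  [nonempty : Nonempty Idx]
  El : Type w'
  str : IndStructure L Idx El
  ll : LLRelation Idx

attribute [instance] IndModel.preorder IndModel.directed IndModel.nonempty

namespace IndModel

variable {L : FirstOrder.Language.{u, v}}

/-- The sentence `φ` has a state declaration, necessarily in the empty context. -/
def Approximable (M : IndModel.{u, v, w, w'} L) (φ : Sentence L) : Prop :=
  M.str.Declared M.ll φ ![]

/-- The model is adequate for the set `T` of sentences, and all sentences in `T` are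
approximable, so that they have an interpretation in the model. -/
def IsModelFor (M : IndModel.{u, v, w, w'} L) (T : Set (Sentence L)) : Prop :=
  M.str.Adequate M.ll T ∧ ∀ φ ∈ T, M.Approximable φ

/-- `M ⊨_≪ φ` for a sentence `φ`. -/
def Satisfies (M : IndModel.{u, v, w, w'} L) (φ : Sentence L) : Prop :=
  M.str.Sat M.ll φ ![] ![]

/-- The refined signature contains `R : C` for all contexts `C` of the length of the arity
of `R`. -/
def HasFullSignature (M : IndModel.{u, v, w, w'} L) : Prop :=
  ∀ (n : ℕ) (R : L.Relations n), M.str.sig R = Set.univ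

end IndModel

/-- `K ⊨_≪ T`: all sentences in `T` are valid in all models in the class `K` that are adequate
for `T`. The collection of all indefinitely extensible models is `K = Set.univ`. -/
def Valid {L : FirstOrder.Language.{u, v}} (K : Set (IndModel.{u, v, w, w'} L))
    (T : Set (Sentence L)) : Prop :=
  ∀ M ∈ K, M.IsModelFor T → ∀ φ ∈ T, M.Satisfies φ

/-- `φ` is a consequence of `Γ` in the class `K`: in all models in `K` that are adequate for
`Γ ∪ {φ}`, if all sentences in `Γ` are valid, then so is `φ`. -/
def Entails {L : FirstOrder.Language.{u, v}} (K : Set (IndModel.{u, v, w, w'} L))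
    (Γ : Set (Sentence L)) (φ : Sentence L) : Prop :=
  ∀ M ∈ K, M.IsModelFor (insert φ Γ) → (∀ ψ ∈ Γ, M.Satisfies ψ) → M.Satisfies φ

/-- The collection of the indefinitely extensible models with full refined signature and with an
indefinitely large `≪`-relation. -/
def fullLargeIndModels (L : FirstOrder.Language.{u, v}) : Set (IndModel.{u, v, w, w'} L) :=
  {M | M.HasFullSignature ∧ M.ll.IsIndefinitelyLarge}

end PotInf

/-! The bridge is the union of the stages, read as an ordinary Tarski structure (`limit`,
`limitRel`). By directedness and compatibility of the instances, `⊨_m` is truth in this limit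
(`satM_iff_realize`). If `≪` is adequate for `T`, then for sentences of `T` the interpretation `⊨_≪`
agrees with `⊨_m` (`Adequate.sat_iff_satM`): every index `i ≫ C` already holds a witness for each
relevant existential formula that has one anywhere, so a quantifier may be confined to `M_i`, and it
does not matter which declared `i` is taken. Hence in a model for `T`, satisfaction of a sentence of
`T` is classical truth in the limit, and soundness is ordinary soundness.

For completeness, a Henkin construction gives an underivable sentence a countermodel on `ℕ`; only
countably many sentences are involved, so this works over any language. It is cut into the finite
stages `{0, …, i}`. What remains is an adequate `≪` (`exists_adequate`): for fixed `C`, `ψ` and `a`,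
all sufficiently late `i` are witness indices, and since `T` and `M_C` are finite, only finitely
many such conditions must hold at once. The resulting relation is indefinitely large and the
signature is full, so the countermodel lies in every admissible class `K`.

Arbitrary `Γ` reduces to finite sets because a derivation uses finitely many assumptions. -/

namespace PotInf

/-! ### Substitution, Tarski semantics and soundness -/

section Semantics

variable {L : FirstOrder.Language.{u, v}} {A : Type*}

theorem extend_comp_extend {X : Type*} {n m : ℕ} (a : Fin m → X) (x : X) (f : Fin n → Fin m) :
    (fun k => extend a x (extend (fun k => (f k).castSucc) (Fin.last m) k)) =
      extend (fun k => a (f k)) x := by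
  funext k
  refine Fin.lastCases ?_ (fun k => ?_) k <;> simp [extend]

namespace Formula

theorem subst_subst {n m p : ℕ} (φ : Formula L n) (f : Fin n → Fin m) (g : Fin m → Fin p) :
    (φ.subst f).subst g = φ.subst (fun k => g (f k)) := by
  have key : ∀ {n m p : ℕ} (f : Fin n → Fin m) (g : Fin m → Fin p),
      (fun k => extend (fun k => (g k).castSucc) (Fin.last p)
        (extend (fun k => (f k).castSucc) (Fin.last m) k)) =
      extend (fun k => (g (f k)).castSucc) (Fin.last p) := by
    intro n m p f g
    funext k
    refine Fin.lastCases ?_ (fun k => ?_) k <;> simp [extend]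
  induction φ generalizing m p with
  | bot => rfl
  | rel => rfl
  | imp φ ψ h₁ h₂ => simp only [subst, h₁, h₂]
  | and φ ψ h₁ h₂ => simp only [subst, h₁, h₂]
  | or φ ψ h₁ h₂ => simp only [subst, h₁, h₂]
  | all φ h => simp only [subst, h, key]
  | ex φ h => simp only [subst, h, key]

theorem subst_id {n : ℕ} (φ : Formula L n) : φ.subst (fun k => k) = φ := by
  have key : ∀ n : ℕ, extend (fun k : Fin n => k.castSucc) (Fin.last n) = fun k => k := by
    intro n
    funext k
    refine Fin.lastCases ?_ (fun k => ?_) k <;> simp [extend]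
  induction φ with
  | bot => rfl
  | rel => rfl
  | imp φ ψ h₁ h₂ => simp only [subst, h₁, h₂]
  | and φ ψ h₁ h₂ => simp only [subst, h₁, h₂]
  | or φ ψ h₁ h₂ => simp only [subst, h₁, h₂]
  | all φ h => simp only [subst, key, h]
  | ex φ h => simp only [subst, key, h]

/-- Tarski semantics in the structure with domain `D` and relations `r`. -/
def Realize (D : Set A) (r : ∀ m : ℕ, L.Relations m → (Fin m → A) → Prop) :
    {n : ℕ} → Formula L n → (Fin n → A) → Prop
  | _, bot, _ => False
  | _, rel R t, a => r _ R (fun k => a (t k))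
  | _, imp φ ψ, a => φ.Realize D r a → ψ.Realize D r a
  | _, and φ ψ, a => φ.Realize D r a ∧ ψ.Realize D r a
  | _, or φ ψ, a => φ.Realize D r a ∨ ψ.Realize D r a
  | _, all φ, a => ∀ b ∈ D, φ.Realize D r (extend a b)
  | _, ex φ, a => ∃ b ∈ D, φ.Realize D r (extend a b)

variable {D : Set A} {r : ∀ m : ℕ, L.Relations m → (Fin m → A) → Prop}

theorem realize_subst {n m : ℕ} (φ : Formula L n) (f : Fin n → Fin m) (a : Fin m → A) :
    (φ.subst f).Realize D r a ↔ φ.Realize D r (fun k => a (f k)) := by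
  induction φ generalizing m with
  | bot => rfl
  | rel => rfl
  | imp φ ψ h₁ h₂ => simp only [subst, Realize, h₁, h₂]
  | and φ ψ h₁ h₂ => simp only [subst, Realize, h₁, h₂]
  | or φ ψ h₁ h₂ => simp only [subst, Realize, h₁, h₂]
  | all φ h => simp only [subst, Realize, h, extend_comp_extend]
  | ex φ h => simp only [subst, Realize, h, extend_comp_extend]

theorem realize_weaken {n : ℕ} (φ : Formula L n) (a : Fin n → A) (b : A) :
    φ.weaken.Realize D r (extend a b) ↔ φ.Realize D r a := by
  simp [weaken, realize_subst, extend]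

theorem realize_inst {n : ℕ} (φ : Formula L (n + 1)) (k : Fin n) (a : Fin n → A) :
    (φ.inst k).Realize D r a ↔ φ.Realize D r (extend a (a k)) := by
  rw [inst, realize_subst]
  congr! 1
  funext j
  refine Fin.lastCases ?_ (fun j => ?_) j <;> simp [extend]

/-- Injectivity of `g` plays no role because the logic has no equality. It serves to pass between
`ℕ` and its lifts to other universes. -/
theorem realize_comp {B : Type*} (g : B → A) (hg : Function.Surjective g) {n : ℕ}
    (φ : Formula L n) (a : Fin n → B) :
    φ.Realize Set.univ (fun m R c => r m R (fun k => g (c k))) a ↔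
      φ.Realize Set.univ r (fun k => g (a k)) := by
  have key : ∀ {n : ℕ} (a : Fin n → B) (b : B),
      (fun k => g (extend a b k)) = extend (fun k => g (a k)) (g b) := by
    intro n a b
    funext k
    refine Fin.lastCases ?_ (fun k => ?_) k <;> simp [extend]
  induction φ with
  | bot => rfl
  | rel => rfl
  | imp φ ψ h₁ h₂ => simp only [Realize, h₁, h₂]
  | and φ ψ h₁ h₂ => simp only [Realize, h₁, h₂]
  | or φ ψ h₁ h₂ => simp only [Realize, h₁, h₂]
  | all φ h => simp only [Realize, h, key, Set.mem_univ, true_imp_iff, hg.forall]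
  | ex φ h => simp only [Realize, h, key, Set.mem_univ, true_and, hg.exists]

end Formula

/-- Soundness relative to a domain `D`: the assignment must stay in `D` so that instances at
variables are legitimate, and non-emptiness of `D` is exactly what `ex_top` needs. -/
theorem Derives.realize {D : Set A} {r : ∀ m : ℕ, L.Relations m → (Fin m → A) → Prop}
    (hD : D.Nonempty) {n : ℕ} {Γ : Set (Formula L n)} {φ : Formula L n} (h : Derives Γ φ)
    (a : Fin n → A) (ha : ∀ k, a k ∈ D) (hΓ : ∀ γ ∈ Γ, γ.Realize D r a) : φ.Realize D r a := by
  have hext : ∀ {n : ℕ} {a : Fin n → A}, (∀ k, a k ∈ D) → ∀ b ∈ D, ∀ k, extend a b k ∈ D := by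
    intro n a ha b hb k
    refine Fin.lastCases ?_ (fun k => ?_) k <;> simp [extend, ha, hb]
  have hw : ∀ {n : ℕ} {Γ : Set (Formula L n)} {a : Fin n → A} (b : A),
      (∀ γ ∈ Γ, γ.Realize D r a) → ∀ γ ∈ Formula.weaken '' Γ, γ.Realize D r (extend a b) := by
    rintro n Γ a b hΓ _ ⟨γ, hγ, rfl⟩
    exact (Formula.realize_weaken γ a b).2 (hΓ γ hγ)
  induction h with
  | assumption h => exact hΓ _ h
  | imp_intro _ ih => exact fun h => ih a ha (Set.forall_mem_insert.2 ⟨h, hΓ⟩)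
  | imp_elim _ _ ih₁ ih₂ => exact ih₁ a ha hΓ (ih₂ a ha hΓ)
  | and_intro _ _ ih₁ ih₂ => exact ⟨ih₁ a ha hΓ, ih₂ a ha hΓ⟩
  | and_left _ ih => exact (ih a ha hΓ).1
  | and_right _ ih => exact (ih a ha hΓ).2
  | or_left _ ih => exact .inl (ih a ha hΓ)
  | or_right _ ih => exact .inr (ih a ha hΓ)
  | or_elim _ _ _ ih ih₁ ih₂ =>
    rcases ih a ha hΓ with h | h
    · exact ih₁ a ha (Set.forall_mem_insert.2 ⟨h, hΓ⟩)
    · exact ih₂ a ha (Set.forall_mem_insert.2 ⟨h, hΓ⟩)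
  | by_contra _ ih =>
    by_contra h
    exact ih a ha (Set.forall_mem_insert.2 ⟨h, hΓ⟩)
  | all_intro _ ih => exact fun b hb => ih _ (hext ha b hb) (hw b hΓ)
  | all_elim k _ ih => exact (Formula.realize_inst _ k a).2 (ih a ha hΓ _ (ha k))
  | ex_intro k _ ih => exact ⟨a k, ha k, (Formula.realize_inst _ k a).1 (ih a ha hΓ)⟩
  | ex_elim _ _ ih₁ ih₂ =>
    obtain ⟨b, hb, h⟩ := ih₁ a ha hΓ
    exact (Formula.realize_weaken _ a b).1
      (ih₂ _ (hext ha b hb) (Set.forall_mem_insert.2 ⟨h, hw b hΓ⟩))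
  | ex_top => exact hD.imp fun b hb => ⟨hb, id⟩

end Semantics

/-! ### Finiteness of derivations and complete sets -/

section Derivations

variable {L : FirstOrder.Language.{u, v}} {n : ℕ}

theorem Derives.mono {Γ Δ : Set (Formula L n)} {φ : Formula L n} (h : Derives Γ φ)
    (hΓ : Γ ⊆ Δ) : Derives Δ φ := by
  induction h with
  | assumption h => exact .assumption (hΓ h)
  | imp_intro _ ih => exact .imp_intro (ih (Set.insert_subset_insert hΓ))
  | imp_elim _ _ ih₁ ih₂ => exact .imp_elim (ih₁ hΓ) (ih₂ hΓ)
  | and_intro _ _ ih₁ ih₂ => exact .and_intro (ih₁ hΓ) (ih₂ hΓ)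
  | and_left _ ih => exact .and_left (ih hΓ)
  | and_right _ ih => exact .and_right (ih hΓ)
  | or_left _ ih => exact .or_left (ih hΓ)
  | or_right _ ih => exact .or_right (ih hΓ)
  | or_elim _ _ _ ih ih₁ ih₂ =>
    exact .or_elim (ih hΓ) (ih₁ (Set.insert_subset_insert hΓ)) (ih₂ (Set.insert_subset_insert hΓ))
  | by_contra _ ih => exact .by_contra (ih (Set.insert_subset_insert hΓ))
  | all_intro _ ih => exact .all_intro (ih (Set.image_mono hΓ))
  | all_elim k _ ih => exact .all_elim k (ih hΓ)
  | ex_intro k _ ih => exact .ex_intro k (ih hΓ)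
  | ex_elim _ _ ih₁ ih₂ =>
    exact .ex_elim (ih₁ hΓ) (ih₂ (Set.insert_subset_insert (Set.image_mono hΓ)))
  | ex_top => exact .ex_top

theorem exists_finite_subset_of_subset_insert {X : Type*} {x : X} {s t : Set X}
    (hs : s ⊆ insert x t) (hf : s.Finite) : ∃ t₀ ⊆ t, t₀.Finite ∧ s ⊆ insert x t₀ :=
  ⟨s ∩ t, Set.inter_subset_right, hf.inter_of_left t, fun _ hy =>
    (hs hy).imp id fun h => ⟨hy, h⟩⟩

theorem Derives.exists_finite {Γ : Set (Formula L n)} {φ : Formula L n} (h : Derives Γ φ) :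
    ∃ Γ₀ ⊆ Γ, Γ₀.Finite ∧ Derives Γ₀ φ := by
  induction h with
  | assumption h => exact ⟨{_}, Set.singleton_subset_iff.2 h, Set.finite_singleton _, .assumption rfl⟩
  | imp_intro _ ih =>
    obtain ⟨Γ₀, h, hf, hd⟩ := ih
    obtain ⟨Γ₁, h₁, hf₁, hs⟩ := exists_finite_subset_of_subset_insert h hf
    exact ⟨Γ₁, h₁, hf₁, .imp_intro (hd.mono hs)⟩
  | imp_elim _ _ ih₁ ih₂ =>
    obtain ⟨Γ₁, h₁, hf₁, hd₁⟩ := ih₁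
    obtain ⟨Γ₂, h₂, hf₂, hd₂⟩ := ih₂
    exact ⟨Γ₁ ∪ Γ₂, Set.union_subset h₁ h₂, hf₁.union hf₂,
      .imp_elim (hd₁.mono Set.subset_union_left) (hd₂.mono Set.subset_union_right)⟩
  | and_intro _ _ ih₁ ih₂ =>
    obtain ⟨Γ₁, h₁, hf₁, hd₁⟩ := ih₁
    obtain ⟨Γ₂, h₂, hf₂, hd₂⟩ := ih₂
    exact ⟨Γ₁ ∪ Γ₂, Set.union_subset h₁ h₂, hf₁.union hf₂,
      .and_intro (hd₁.mono Set.subset_union_left) (hd₂.mono Set.subset_union_right)⟩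
  | and_left _ ih => exact ih.imp fun _ h => ⟨h.1, h.2.1, .and_left h.2.2⟩
  | and_right _ ih => exact ih.imp fun _ h => ⟨h.1, h.2.1, .and_right h.2.2⟩
  | or_left _ ih => exact ih.imp fun _ h => ⟨h.1, h.2.1, .or_left h.2.2⟩
  | or_right _ ih => exact ih.imp fun _ h => ⟨h.1, h.2.1, .or_right h.2.2⟩
  | or_elim _ _ _ ih ih₁ ih₂ =>
    obtain ⟨Γ₀, h₀, hf₀, hd₀⟩ := ih
    obtain ⟨Γ₁, h₁, hf₁, hd₁⟩ := ih₁
    obtain ⟨Γ₂, h₂, hf₂, hd₂⟩ := ih₂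
    obtain ⟨Δ₁, g₁, gf₁, hs₁⟩ := exists_finite_subset_of_subset_insert h₁ hf₁
    obtain ⟨Δ₂, g₂, gf₂, hs₂⟩ := exists_finite_subset_of_subset_insert h₂ hf₂
    refine ⟨Γ₀ ∪ (Δ₁ ∪ Δ₂), Set.union_subset h₀ (Set.union_subset g₁ g₂),
      hf₀.union (gf₁.union gf₂), .or_elim (hd₀.mono Set.subset_union_left)
        (hd₁.mono (hs₁.trans (Set.insert_subset_insert ?_)))
        (hd₂.mono (hs₂.trans (Set.insert_subset_insert ?_)))⟩
    · exact Set.subset_union_left.trans Set.subset_union_right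
    · exact Set.subset_union_right.trans Set.subset_union_right
  | by_contra _ ih =>
    obtain ⟨Γ₀, h, hf, hd⟩ := ih
    obtain ⟨Γ₁, h₁, hf₁, hs⟩ := exists_finite_subset_of_subset_insert h hf
    exact ⟨Γ₁, h₁, hf₁, .by_contra (hd.mono hs)⟩
  | all_intro _ ih =>
    obtain ⟨Γ₀, h, hf, hd⟩ := ih
    obtain ⟨Γ₁, h₁, hf₁, rfl⟩ := Set.exists_subset_image_finite_and.1 ⟨Γ₀, h, hf, rfl⟩
    exact ⟨Γ₁, h₁, hf₁, .all_intro hd⟩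
  | all_elim k _ ih => exact ih.imp fun _ h => ⟨h.1, h.2.1, .all_elim k h.2.2⟩
  | ex_intro k _ ih => exact ih.imp fun _ h => ⟨h.1, h.2.1, .ex_intro k h.2.2⟩
  | ex_elim _ _ ih₁ ih₂ =>
    obtain ⟨Γ₁, h₁, hf₁, hd₁⟩ := ih₁
    obtain ⟨Γ₂, h₂, hf₂, hd₂⟩ := ih₂
    obtain ⟨Δ₂, g₂, gf₂, hs₂⟩ := exists_finite_subset_of_subset_insert h₂ hf₂
    obtain ⟨Θ, k, kf, hk⟩ := Set.exists_subset_image_finite_and.1 ⟨Δ₂, g₂, gf₂, rfl⟩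
    subst hk
    exact ⟨Γ₁ ∪ Θ, Set.union_subset h₁ k, hf₁.union kf,
      .ex_elim (hd₁.mono Set.subset_union_left)
        (hd₂.mono (hs₂.trans (Set.insert_subset_insert (Set.image_mono Set.subset_union_right))))⟩
  | ex_top => exact ⟨∅, Set.empty_subset _, Set.finite_empty, .ex_top⟩

theorem Derives.of_bot {Γ : Set (Formula L n)} (h : Derives Γ .bot) (φ : Formula L n) :
    Derives Γ φ :=
  .by_contra (h.mono (Set.subset_insert _ _))

theorem Derives.cut {Γ : Set (Formula L n)} {φ ψ : Formula L n} (h : Derives Γ φ)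
    (h' : Derives (insert φ Γ) ψ) : Derives Γ ψ :=
  .imp_elim (.imp_intro h') h

/-- A consistent set of formulas that contains each formula or its negation. -/
structure IsComplete (Γ : Set (Formula L n)) : Prop where
  consistent : ¬ Derives Γ .bot
  mem_or_neg_mem : ∀ φ : Formula L n, φ ∈ Γ ∨ φ.neg ∈ Γ

/-- Lindenbaum's lemma: a maximal consistent set, from Zorn, decides every formula, since otherwise
adding `φ` and adding `φ.neg` would both be inconsistent and a cut would refute the set itself. -/
theorem exists_isComplete {Γ : Set (Formula L n)} (h : ¬ Derives Γ .bot) :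
    ∃ Δ, Γ ⊆ Δ ∧ IsComplete Δ := by
  obtain ⟨Δ, hΓ, hΔ⟩ := zorn_subset_nonempty {Δ : Set (Formula L n) | ¬ Derives Δ .bot}
    (fun c hc hchain hne => ⟨⋃₀ c, fun hd => by
      -- A derivation of `⊥` from the union of the chain uses finitely many formulas, which all lie
      -- in one member.
      obtain ⟨Γ₀, h₀, hf, hd⟩ := hd.exists_finite
      obtain ⟨s, hs, hsub⟩ :=
        DirectedOn.exists_mem_subset_of_finite_of_subset_sUnion hne hchain.directedOn hf h₀
      exact hc hs (hd.mono hsub), fun s hs => Set.subset_sUnion_of_mem hs⟩) Γ h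
  refine ⟨Δ, hΓ, hΔ.prop, fun φ => ?_⟩
  by_contra! hφ
  have key : ∀ χ, χ ∉ Δ → Derives (insert χ Δ) .bot := by
    intro χ hχ
    by_contra hc
    exact hχ (hΔ.le_of_ge hc (Set.subset_insert _ _) (Set.mem_insert _ _))
  exact hΔ.prop ((Derives.by_contra (key _ hφ.2)).cut (key _ hφ.1))

namespace IsComplete

variable {Γ : Set (Formula L n)} (hΓ : IsComplete Γ)
include hΓ

theorem mem_iff_derives {φ : Formula L n} : φ ∈ Γ ↔ Derives Γ φ := by
  refine ⟨.assumption, fun h => (hΓ.mem_or_neg_mem φ).resolve_right fun hn => ?_⟩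
  exact hΓ.consistent (.imp_elim (.assumption hn) h)

theorem neg_mem_iff {φ : Formula L n} : φ.neg ∈ Γ ↔ φ ∉ Γ :=
  ⟨fun hn h => hΓ.consistent (.imp_elim (.assumption hn) (.assumption h)),
    (hΓ.mem_or_neg_mem φ).resolve_left⟩

theorem bot_notMem : Formula.bot ∉ Γ := fun h => hΓ.consistent (.assumption h)

theorem imp_mem_iff {φ ψ : Formula L n} : φ.imp ψ ∈ Γ ↔ (φ ∈ Γ → ψ ∈ Γ) := by
  refine ⟨fun h h' => hΓ.mem_iff_derives.2 (.imp_elim (.assumption h) (.assumption h')),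
    fun h => hΓ.mem_iff_derives.2 (.imp_intro ?_)⟩
  by_cases hφ : φ ∈ Γ
  · exact .assumption (.inr (h hφ))
  · exact Derives.of_bot (.imp_elim (.assumption (.inr (hΓ.neg_mem_iff.2 hφ)))
      (.assumption (.inl rfl))) _

theorem and_mem_iff {φ ψ : Formula L n} : φ.and ψ ∈ Γ ↔ φ ∈ Γ ∧ ψ ∈ Γ := by
  simp only [hΓ.mem_iff_derives]
  exact ⟨fun h => ⟨.and_left h, .and_right h⟩, fun h => .and_intro h.1 h.2⟩

theorem or_mem_iff {φ ψ : Formula L n} : φ.or ψ ∈ Γ ↔ φ ∈ Γ ∨ ψ ∈ Γ := by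
  refine ⟨fun h => ?_, fun h => hΓ.mem_iff_derives.2
    (h.elim (fun h => .or_left (.assumption h)) fun h => .or_right (.assumption h))⟩
  by_contra! hn
  refine hΓ.consistent (.or_elim (.assumption h) ?_ ?_)
  · exact .imp_elim (.assumption (.inr (hΓ.neg_mem_iff.2 hn.1))) (.assumption (.inl rfl))
  · exact .imp_elim (.assumption (.inr (hΓ.neg_mem_iff.2 hn.2))) (.assumption (.inl rfl))

end IsComplete

/-- Each complete set has a complete extension in one more variable that contains a prescribed
formula, if this is consistent. -/
theorem IsComplete.exists_succ {Γ : Set (Formula L n)} (hΓ : IsComplete Γ)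
    (θ : Formula L (n + 1)) :
    ∃ Δ : Set (Formula L (n + 1)), IsComplete Δ ∧ Formula.weaken '' Γ ⊆ Δ ∧
      (¬ Derives (insert θ (Formula.weaken '' Γ)) .bot → θ ∈ Δ) := by
  by_cases h : Derives (insert θ (Formula.weaken '' Γ)) .bot
  · obtain ⟨Δ, hs, hΔ⟩ := exists_isComplete (Γ := Formula.weaken '' Γ) fun hd =>
      hΓ.consistent (.ex_elim (χ := .bot) .ex_top (hd.mono (Set.subset_insert _ _)))
    exact ⟨Δ, hΔ, hs, fun h' => (h' h).elim⟩
  · obtain ⟨Δ, hs, hΔ⟩ := exists_isComplete h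
    exact ⟨Δ, hΔ, (Set.subset_insert _ _).trans hs, fun _ => hs (Set.mem_insert _ _)⟩

end Derivations
-- Henkin construction with variables as witnesses
section Henkin

variable {L : FirstOrder.Language.{u, v}}

theorem Formula.finite_subformulas {n : ℕ} (φ : Formula L n) : φ.subformulas.Finite := by
  induction φ with
  | bot => exact Set.finite_singleton _
  | rel => exact Set.finite_singleton _
  | imp φ ψ h₁ h₂ => exact (Set.finite_singleton _).union (h₁.union h₂)
  | and φ ψ h₁ h₂ => exact (Set.finite_singleton _).union (h₁.union h₂)
  | or φ ψ h₁ h₂ => exact (Set.finite_singleton _).union (h₁.union h₂)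
  | all φ h => exact (Set.finite_singleton _).union h
  | ex φ h => exact (Set.finite_singleton _).union h

theorem Formula.mem_subformulas {n : ℕ} (φ : Formula L n) :
    (⟨n, φ⟩ : Σ k, Formula L k) ∈ φ.subformulas := by
  cases φ <;> simp [subformulas]

theorem extend_lt {n s b : ℕ} {a : Fin n → ℕ} (ha : ∀ k, a k < s) (hb : b < s) (k : Fin (n + 1)) :
    extend a b k < s := by
  refine Fin.lastCases ?_ (fun k => ?_) k <;> simp [extend, ha, hb]

theorem lt_succ_of_forall_lt {n s : ℕ} {a : Fin n → ℕ} (ha : ∀ k, a k < s) (k : Fin n) :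
    a k < s + 1 :=
  (ha k).trans s.lt_succ_self

/-- The formula with the variables `x_{a k}`, which are below `xₛ`, in place of its free
variables. -/
def Formula.rename {n : ℕ} (φ : Formula L n) (a : Fin n → ℕ) (s : ℕ) (ha : ∀ k, a k < s) :
    Formula L s :=
  φ.subst fun k => ⟨a k, ha k⟩

namespace Formula

theorem weaken_rename {n s : ℕ} (φ : Formula L n) (a : Fin n → ℕ) (ha : ∀ k, a k < s) :
    (φ.rename a s ha).weaken = φ.rename a (s + 1) (lt_succ_of_forall_lt ha) :=
  subst_subst φ _ _

/-- At stage `s` the bound variable is `xₛ`, the same variable that is new at stage `s + 1`. So the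
body of a renamed quantified formula is literally its Henkin instance at the fresh variable, and no
constants are needed. -/
theorem extend_castSucc_last {n s : ℕ} (a : Fin n → ℕ) (ha : ∀ k, a k < s) :
    extend (fun k => (⟨a k, ha k⟩ : Fin s).castSucc) (Fin.last s) =
      fun k => ⟨extend a s k, extend_lt (lt_succ_of_forall_lt ha) s.lt_succ_self k⟩ := by
  funext k
  refine Fin.lastCases ?_ (fun k => ?_) k <;> simp [extend, Fin.ext_iff]

theorem rename_all {n s : ℕ} (φ : Formula L (n + 1)) (a : Fin n → ℕ) (ha : ∀ k, a k < s) :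
    (all φ).rename a s ha = all (φ.rename (extend a s) (s + 1)
      (extend_lt (lt_succ_of_forall_lt ha) s.lt_succ_self)) := by
  simp only [rename, subst, extend_castSucc_last]

theorem rename_ex {n s : ℕ} (φ : Formula L (n + 1)) (a : Fin n → ℕ) (ha : ∀ k, a k < s) :
    (ex φ).rename a s ha = ex (φ.rename (extend a s) (s + 1)
      (extend_lt (lt_succ_of_forall_lt ha) s.lt_succ_self)) := by
  simp only [rename, subst, extend_castSucc_last]

theorem inst_rename {n s b : ℕ} (φ : Formula L (n + 1)) (a : Fin n → ℕ) (ha : ∀ k, a k < s)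
    (hb : b < s) :
    (φ.rename (extend a s) (s + 1) (extend_lt (lt_succ_of_forall_lt ha) s.lt_succ_self)).inst
      ⟨b, hb⟩ = φ.rename (extend a b) s (extend_lt ha hb) := by
  rw [rename, ← extend_castSucc_last a ha, inst, subst_subst, rename]
  congr 1
  funext k
  refine Fin.lastCases ?_ (fun k => ?_) k
  · simp [extend]
  · simp only [extend, Fin.snoc_castSucc, id]

end Formula

/-- For a countable set of formulas there is an enumeration of the formulas that are obtained when
their last variable is renamed to the new variable `xₛ` of stage `s`. -/
theorem exists_enumeration (F : Set (Σ k, Formula L k)) (hF : F.Countable) :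
    ∃ θ : ∀ s : ℕ, Formula L (s + 1), ∀ (n : ℕ) (ψ : Formula L (n + 1)) (a : Fin n → ℕ) (s₀ : ℕ),
      ⟨n + 1, ψ⟩ ∈ F → ∀ ha : ∀ k, a k < s₀, ∃ (s : ℕ) (hs : s₀ ≤ s),
        θ s = ψ.rename (extend a s) (s + 1)
          (extend_lt (lt_succ_of_forall_lt fun k => (ha k).trans_le hs) s.lt_succ_self) := by
  classical
  let G : Set (Σ k, Formula L (k + 1)) := (fun x => (⟨x.1 + 1, x.2⟩ : Σ k, Formula L k)) ⁻¹' F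
  have hinj : Function.Injective
      (fun x : Σ k, Formula L (k + 1) => (⟨x.1 + 1, x.2⟩ : Σ k, Formula L k)) := by
    rintro ⟨k, φ⟩ ⟨l, ψ⟩ h
    cases h
    rfl
  have : Countable G := (hF.preimage hinj).to_subtype
  -- `Option` keeps the enumerated type non-empty even if there are no formulas to treat.
  obtain ⟨f, hf⟩ := exists_surjective_nat (Option (Σ x : G, (Fin x.1.1 → ℕ)))
  refine ⟨fun s => match f s.unpair.1 with
    | none => .bot
    | some y => if h : ∀ k, y.2 k < s then y.1.1.2.rename (extend y.2 s) (s + 1)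
        (extend_lt (lt_succ_of_forall_lt h) s.lt_succ_self) else .bot, ?_⟩
  intro n ψ a s₀ hψ ha
  obtain ⟨i, hi⟩ := hf (some ⟨⟨⟨n, ψ⟩, hψ⟩, a⟩)
  -- Stage `s` treats item `s.unpair.1`, so item `i` recurs at the stages `Nat.pair i s₀`, which are
  -- at least `s₀`.
  refine ⟨Nat.pair i s₀, Nat.right_le_pair i s₀, ?_⟩
  have h : ∀ k, a k < Nat.pair i s₀ := fun k => (ha k).trans_le (Nat.right_le_pair i s₀)
  simp [Nat.unpair_pair, hi, h]

/-- An increasing sequence of complete sets, one for each number of variables. -/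
theorem exists_isComplete_sequence {Γ : Set (Sentence L)} (hΓ : ¬ Derives Γ .bot)
    (θ : ∀ s : ℕ, Formula L (s + 1)) :
    ∃ T : ∀ s : ℕ, Set (Formula L s), Γ ⊆ T 0 ∧ (∀ s, IsComplete (T s)) ∧
      (∀ s, Formula.weaken '' T s ⊆ T (s + 1)) ∧
      ∀ s, ¬ Derives (insert (θ s) (Formula.weaken '' T s)) .bot → θ s ∈ T (s + 1) := by
  obtain ⟨Γ', hs, hΓ'⟩ := exists_isComplete hΓ
  choose next hnext using fun (s : ℕ) (Δ : {Δ : Set (Formula L s) // IsComplete Δ}) =>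
    Δ.2.exists_succ (θ s)
  let T : ∀ s : ℕ, {Δ : Set (Formula L s) // IsComplete Δ} := fun s =>
    Nat.rec ⟨Γ', hΓ'⟩ (fun s Δ => ⟨next s Δ, (hnext s Δ).1⟩) s
  exact ⟨fun s => (T s).1, hs, fun s => (T s).2, fun s => (hnext s (T s)).2.1,
    fun s => (hnext s (T s)).2.2⟩

/-- Extensions are conservative: a formula missing at stage `s` has its negation there by
completeness, and the negation is carried upwards. -/
theorem rename_mem_iff {T : ∀ s : ℕ, Set (Formula L s)} (hT : ∀ s, IsComplete (T s))
    (hw : ∀ s, Formula.weaken '' T s ⊆ T (s + 1)) {n : ℕ} (φ : Formula L n) (a : Fin n → ℕ)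
    {s s' : ℕ} (ha : ∀ k, a k < s) (ha' : ∀ k, a k < s') :
    φ.rename a s ha ∈ T s ↔ φ.rename a s' ha' ∈ T s' := by
  wlog h : s ≤ s' generalizing s s'
  · exact (this ha' ha (le_of_not_ge h)).symm
  induction s', h using Nat.le_induction with
  | base => rfl
  | succ s' h ih =>
    have ha'' : ∀ k, a k < s' := fun k => (ha k).trans_le h
    rw [ih ha'', ← Formula.weaken_rename φ a ha'']
    refine ⟨fun h => hw s' ⟨_, h, rfl⟩, fun h => ?_⟩
    by_contra hn
    exact (hT (s' + 1)).neg_mem_iff.1 (hw s' ⟨_, (hT s').neg_mem_iff.2 hn, rfl⟩) h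

/-- The truth lemma for a Henkin sequence of complete sets. -/
theorem rename_mem_iff_realize {T : ∀ s : ℕ, Set (Formula L s)} (hT : ∀ s, IsComplete (T s))
    (hw : ∀ s, Formula.weaken '' T s ⊆ T (s + 1)) (θ : ∀ s : ℕ, Formula L (s + 1))
    (hθ : ∀ s, ¬ Derives (insert (θ s) (Formula.weaken '' T s)) .bot → θ s ∈ T (s + 1))
    (S : Set (Σ k, Formula L k))
    (hS : ∀ (n : ℕ) (ψ : Formula L (n + 1)) (a : Fin n → ℕ) (s₀ : ℕ),
      (⟨n + 1, ψ⟩ ∈ S ∨ ∃ χ : Formula L (n + 1), ψ = χ.neg ∧ ⟨n + 1, χ⟩ ∈ S) →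
        ∀ ha : ∀ k, a k < s₀, ∃ (s : ℕ) (hs : s₀ ≤ s),
          θ s = ψ.rename (extend a s) (s + 1)
            (extend_lt (lt_succ_of_forall_lt fun k => (ha k).trans_le hs) s.lt_succ_self))
    {n : ℕ} (φ : Formula L n) (hφ : φ.subformulas ⊆ S) (a : Fin n → ℕ) (s : ℕ)
    (ha : ∀ k, a k < s) :
    φ.rename a s ha ∈ T s ↔ φ.Realize Set.univ (fun m R c =>
      ∃ (s : ℕ) (hc : ∀ k, c k < s), (Formula.rel R fun k : Fin m => k).rename c s hc ∈ T s) a := by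
  induction φ generalizing s with
  | bot => exact iff_of_false (hT s).bot_notMem id
  | rel R t =>
    refine ⟨fun h => ⟨s, fun k => ha (t k), h⟩, fun ⟨s', hc, h⟩ => ?_⟩
    -- Renaming `R t` along `a` is, by definition, renaming `R x₀ … xₘ₋₁` along `a ∘ t`.
    exact (rename_mem_iff hT hw (.rel R fun k => k) (fun k => a (t k)) (fun k => ha (t k)) hc).2 h
  | imp φ ψ h₁ h₂ =>
    rw [Formula.subformulas, Set.union_subset_iff, Set.union_subset_iff] at hφ
    exact (hT s).imp_mem_iff.trans (imp_congr (h₁ hφ.2.1 a s ha) (h₂ hφ.2.2 a s ha))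
  | and φ ψ h₁ h₂ =>
    rw [Formula.subformulas, Set.union_subset_iff, Set.union_subset_iff] at hφ
    exact (hT s).and_mem_iff.trans (and_congr (h₁ hφ.2.1 a s ha) (h₂ hφ.2.2 a s ha))
  | or φ ψ h₁ h₂ =>
    rw [Formula.subformulas, Set.union_subset_iff, Set.union_subset_iff] at hφ
    exact (hT s).or_mem_iff.trans (or_congr (h₁ hφ.2.1 a s ha) (h₂ hφ.2.2 a s ha))
  | all φ ih =>
    rw [Formula.subformulas, Set.union_subset_iff] at hφ
    constructor
    · intro h b _
      have has : ∀ k, a k < max s (b + 1) := fun k => (ha k).trans_le (le_max_left _ _)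
      have hb : b < max s (b + 1) := Nat.lt_of_succ_le (le_max_right _ _)
      rw [rename_mem_iff hT hw _ a ha has, Formula.rename_all, (hT _).mem_iff_derives] at h
      rw [← ih hφ.2 _ _ (extend_lt has hb), (hT _).mem_iff_derives, ← Formula.inst_rename φ a has hb]
      exact .all_elim _ h
    · intro h
      -- The stage `s'` at which `x_{s'}` is offered as a counterexample. If `¬φ(x_{s'})` were
      -- refutable there, `φ(x_{s'})` would be derivable with `x_{s'}` fresh, and `∀ x φ` would
      -- follow.
      obtain ⟨s', hs, hs'⟩ := hS _ φ.neg a s (.inr ⟨φ, rfl, hφ.2 φ.mem_subformulas⟩) ha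
      have has : ∀ k, a k < s' := fun k => (ha k).trans_le hs
      by_contra hn
      rw [rename_mem_iff hT hw _ a ha has, Formula.rename_all, (hT _).mem_iff_derives] at hn
      have hmem := hθ s' fun hd => hn (.all_intro (.by_contra (by rwa [hs'] at hd)))
      rw [hs'] at hmem
      exact (hT _).neg_mem_iff.1 hmem ((ih hφ.2 _ _ _).2 (h s' trivial))
  | ex φ ih =>
    rw [Formula.subformulas, Set.union_subset_iff] at hφ
    constructor
    · intro h
      obtain ⟨s', hs, hs'⟩ := hS _ φ a s (.inl (hφ.2 φ.mem_subformulas)) ha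
      have has : ∀ k, a k < s' := fun k => (ha k).trans_le hs
      rw [rename_mem_iff hT hw _ a ha has, Formula.rename_ex] at h
      -- A refutation of the fresh instance would refute `T s'` by `ex_elim`, since `∃ x φ` is in `T
      -- s'`.
      have hmem := hθ s' fun hd => (hT s').consistent (.ex_elim (.assumption h) (hs' ▸ hd))
      rw [hs'] at hmem
      exact ⟨s', trivial, (ih hφ.2 _ _ _).1 hmem⟩
    · rintro ⟨b, _, h⟩
      have has : ∀ k, a k < max s (b + 1) := fun k => (ha k).trans_le (le_max_left _ _)
      have hb : b < max s (b + 1) := Nat.lt_of_succ_le (le_max_right _ _)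
      rw [← ih hφ.2 _ _ (extend_lt has hb), (hT _).mem_iff_derives,
        ← Formula.inst_rename φ a has hb] at h
      rw [rename_mem_iff hT hw _ a ha has, Formula.rename_ex, (hT _).mem_iff_derives]
      exact .ex_intro _ h

theorem Formula.rename_of_isEmpty (φ : Sentence L) (a : Fin 0 → ℕ) (ha : ∀ k, a k < 0) :
    φ.rename a 0 ha = φ := by
  conv_rhs => rw [← φ.subst_id]
  rw [rename]
  congr 1
  exact Subsingleton.elim _ _

/-- The completeness theorem of classical first-order logic, for countable sets of sentences. -/
theorem exists_realize_of_not_derives {Γ : Set (Sentence L)} (hΓ : Γ.Countable) {φ : Sentence L}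
    (h : ¬ Derives Γ φ) :
    ∃ r : ∀ m : ℕ, L.Relations m → (Fin m → ℕ) → Prop,
      (∀ γ ∈ Γ, γ.Realize Set.univ r ![]) ∧ ¬ φ.Realize Set.univ r ![] := by
  let S : Set (Σ k, Formula L k) := ⋃ γ ∈ insert φ Γ, γ.subformulas
  have hSc : S.Countable :=
    (hΓ.insert φ).biUnion fun γ _ => γ.finite_subformulas.countable
  have hsub : ∀ γ ∈ insert φ Γ, γ.subformulas ⊆ S := fun γ hγ =>
    Set.subset_biUnion_of_mem (u := fun γ : Sentence L => γ.subformulas) hγ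
  -- The negations are included for the universal case of the truth lemma, which looks for
  -- counterexamples.
  obtain ⟨θ, hθ⟩ := exists_enumeration
    (S ∪ (fun x : Σ k, Formula L k => (⟨x.1, x.2.neg⟩ : Σ k, Formula L k)) '' S)
    (hSc.union (hSc.image _))
  obtain ⟨T, h₀, hT, hw, hθT⟩ := exists_isComplete_sequence (Γ := insert φ.neg Γ)
    (fun hd => h (.by_contra hd)) θ
  have truth := fun γ hγ => rename_mem_iff_realize hT hw θ hθT S (fun n ψ a s₀ hψ ha =>
    hθ n ψ a s₀ (hψ.imp id fun ⟨χ, hχ, hS⟩ => ⟨_, hS, by rw [hχ]⟩) ha) γ (hsub γ hγ) ![] 0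
    (fun k => k.elim0)
  simp only [Formula.rename_of_isEmpty] at truth
  exact ⟨_, fun γ hγ => (truth γ (.inr hγ)).1 (h₀ (.inr hγ)), fun hr =>
    (hT 0).neg_mem_iff.1 (h₀ (.inl rfl)) ((truth φ (.inl rfl)).2 hr)⟩

end Henkin
-- Indefinitely large sets and hereditary `≪`-relations
section Large

variable {I : Type w}

/-- Large sets are cofinal; this provides an assignment `R : J` above any given context. -/
theorem IsLarge.exists_ge [Preorder I] [IsDirectedOrder I] {n : ℕ} {H : Set (Fin n → I)} (hH : IsLarge n H)
    (C : Fin n → I) : ∃ J ∈ H, ∀ k, C k ≤ J k := by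
  induction n with
  | zero => exact ⟨![], by rw [hH]; rfl, fun k => k.elim0⟩
  | succ n ih =>
    obtain ⟨J, ⟨i₀, hi₀⟩, hJ⟩ := ih hH (Fin.init C)
    obtain ⟨i, hi, hC⟩ := exists_ge_ge i₀ (C (Fin.last n))
    refine ⟨extend J i, hi₀ i hi, fun k => ?_⟩
    refine Fin.lastCases ?_ (fun k => ?_) k
    · simpa [extend] using hC
    · simpa [extend, Fin.init] using hJ k

theorem IsLarge.mono [Preorder I] {n : ℕ} {H H' : Set (Fin n → I)} (hH : IsLarge n H) (h : H ⊆ H') :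
    IsLarge n H' := by
  induction n with
  | zero =>
    refine Set.eq_singleton_iff_unique_mem.2 ⟨h ?_, fun _ _ => Subsingleton.elim _ _⟩
    rw [hH]
    rfl
  | succ n ih =>
    exact ih (H := {C | ∃ i₀ : I, ∀ i, i₀ ≤ i → extend C i ∈ H}) hH
      fun C ⟨i₀, hi⟩ => ⟨i₀, fun i hi₀ => h (hi i hi₀)⟩

theorem isLarge_univ [Preorder I] [Nonempty I] (n : ℕ) : IsLarge n (Set.univ : Set (Fin n → I)) := by
  induction n with
  | zero => exact Set.eq_singleton_iff_unique_mem.2 ⟨trivial, fun _ _ => Subsingleton.elim _ _⟩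
  | succ n ih => exact ih.mono fun C _ => ⟨Classical.arbitrary I, fun _ _ => trivial⟩

/-- The contexts all of whose initial segments of length `n + 1` are in `H n`. -/
def hereditaryContexts (H : ∀ n : ℕ, Set (Fin (n + 1) → I)) : ∀ n : ℕ, Set (Fin n → I)
  | 0 => Set.univ
  | n + 1 => {C | (Fin.init C : Fin n → I) ∈ hereditaryContexts H n ∧ C ∈ H n}

theorem extend_mem_hereditaryContexts {H : ∀ n : ℕ, Set (Fin (n + 1) → I)} {n : ℕ}
    {C : Fin n → I} {i : I} :
    extend C i ∈ hereditaryContexts H (n + 1) ↔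
      C ∈ hereditaryContexts H n ∧ extend C i ∈ H n := by
  simp [hereditaryContexts, extend]

/-- The `≪`-relation of the contexts all of whose initial segments of length `n + 1` are
in `H n`. -/
def LLRelation.hereditary (H : ∀ n : ℕ, Set (Fin (n + 1) → I)) : LLRelation I where
  ctx := hereditaryContexts H
  of_extend _ _ h := (extend_mem_hereditaryContexts.1 h).1

variable [Preorder I] {H : ∀ n : ℕ, Set (Fin (n + 1) → I)}
  (hH : ∀ (n : ℕ) (C : Fin n → I), ∃ i₀ : I, ∀ i, i₀ ≤ i → extend C i ∈ H n)
include hH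

theorem LLRelation.isIndefinitelyLarge_hereditary :
    (LLRelation.hereditary H).IsIndefinitelyLarge := by
  intro n
  induction n with
  | zero => exact Set.eq_singleton_iff_unique_mem.2 ⟨trivial, fun _ _ => Subsingleton.elim _ _⟩
  | succ n ih =>
    refine IsLarge.mono (n := n) ih fun C hC => ?_
    obtain ⟨i₀, hi₀⟩ := hH n C
    exact ⟨i₀, fun i hi => extend_mem_hereditaryContexts.2 ⟨hC, hi₀ i hi⟩⟩

/-- Short contexts are prolonged by `hH`, long ones truncated by heredity; these are the two cases
in the definition of `generated`. -/
theorem exists_mem_hereditaryContexts {m : ℕ} {C : Fin m → I} (hC : C ∈ hereditaryContexts H m)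
    (n : ℕ) : ∃ D ∈ hereditaryContexts H n,
      ∀ (k : ℕ) (hm : k < m) (hn : k < n), C ⟨k, hm⟩ = D ⟨k, hn⟩ := by
  rcases le_total m n with h | h
  · induction n, h using Nat.le_induction with
    | base => exact ⟨C, hC, fun _ _ _ => rfl⟩
    | succ n h ih =>
      obtain ⟨D, hD, hCD⟩ := ih
      obtain ⟨i, hi⟩ := hH n D
      refine ⟨extend D i, extend_mem_hereditaryContexts.2 ⟨hD, hi i le_rfl⟩, fun k hm hn => ?_⟩
      rw [hCD k hm (hm.trans_le h)]
      exact (Fin.snoc_castSucc (α := fun _ => I) i D ⟨k, hm.trans_le h⟩).symm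
  · induction m, h using Nat.le_induction with
    | base => exact ⟨C, hC, fun _ _ _ => rfl⟩
    | succ m h ih =>
      obtain ⟨D, hD, hCD⟩ := ih hC.1
      exact ⟨D, hD, fun k _ hn => hCD k (hn.trans_le h) hn⟩

theorem hereditaryContexts_subset_generated (n m : ℕ) :
    hereditaryContexts H m ⊆ generated (H n) m := by
  intro C hC
  obtain ⟨D, hD, h⟩ := exists_mem_hereditaryContexts hH hC (n + 1)
  exact ⟨D, hD.2, h⟩

end Large

/-! ### The limit structure, the reflection principle and adequate relations -/

namespace IndStructure

variable {L : FirstOrder.Language.{u, v}} {I : Type w} [Preorder I] {A : Type w'}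
  (M : IndStructure L I A)

/-- The union of the stages of the structure. -/
def limit : Set A := {a | ∃ i, a ∈ M.carrier i}

/-- The union of the instances of a relation. -/
def limitRel (m : ℕ) (R : L.Relations m) (a : Fin m → A) : Prop := ∃ J ∈ M.sig R, a ∈ M.rel R J

theorem extend_mem_prod {n : ℕ} {C : Fin n → I} {a : Fin n → A} (ha : a ∈ M.prod C) {i : I}
    {b : A} (hb : b ∈ M.carrier i) : extend a b ∈ M.prod (extend C i) := by
  intro k
  refine Fin.lastCases ?_ (fun k => ?_) k
  · simpa [extend] using hb
  · simpa [extend] using ha k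

theorem finite_prod {n : ℕ} (C : Fin n → I) : (M.prod C).Finite :=
  Set.Finite.subset (Set.Finite.pi fun k => M.carrier_finite (C k)) fun _ ha k _ => ha k

/-- The interpretation `⊨_m` is the Tarski semantics in the limit. -/
theorem satM_iff_realize [IsDirectedOrder I] {n : ℕ} (φ : Formula L n) (C : Fin n → I)
    (a : Fin n → A) (ha : a ∈ M.prod C) :
    M.SatM φ C a ↔ φ.Realize M.limit M.limitRel a := by
  induction φ with
  | bot => rfl
  | rel R t =>
    refine ⟨fun ⟨J, hJ, _, h⟩ => ⟨J, hJ, h⟩, fun ⟨J, hJ, h⟩ => ?_⟩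
    -- `J` need not lie above the context; compatibility transfers the relation to an assignment
    -- `J'` that does.
    obtain ⟨J', hJ', hC⟩ := (M.sig_large R).exists_ge fun k => C (t k)
    exact ⟨J', hJ', hC, (M.rel_compatible R J J' hJ hJ' _ (M.rel_subset R J hJ _ h)
      fun k => M.carrier_mono (hC k) (ha (t k))).1 h⟩
  | imp φ ψ h₁ h₂ => simp only [SatM, Formula.Realize, h₁ C a ha, h₂ C a ha]
  | and φ ψ h₁ h₂ => simp only [SatM, Formula.Realize, h₁ C a ha, h₂ C a ha]
  | or φ ψ h₁ h₂ => simp only [SatM, Formula.Realize, h₁ C a ha, h₂ C a ha]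
  | all φ ih =>
    exact ⟨fun h b ⟨i, hb⟩ => (ih _ _ (M.extend_mem_prod ha hb)).1 (h i b hb),
      fun h i b hb => (ih _ _ (M.extend_mem_prod ha hb)).2 (h b ⟨i, hb⟩)⟩
  | ex φ ih =>
    exact ⟨fun ⟨i, b, hb, h⟩ => ⟨b, ⟨i, hb⟩, (ih _ _ (M.extend_mem_prod ha hb)).1 h⟩,
      fun ⟨b, ⟨i, hb⟩, h⟩ => ⟨i, b, hb, (ih _ _ (M.extend_mem_prod ha hb)).2 h⟩⟩

theorem satM_elimAll {n : ℕ} (φ : Formula L n) (C : Fin n → I) (a : Fin n → A) :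
    M.SatM φ.elimAll C a ↔ M.SatM φ C a := by
  induction φ with
  | bot => rfl
  | rel => rfl
  | imp φ ψ h₁ h₂ => simp only [Formula.elimAll, SatM, h₁, h₂]
  | and φ ψ h₁ h₂ => simp only [Formula.elimAll, SatM, h₁, h₂]
  | or φ ψ h₁ h₂ => simp only [Formula.elimAll, SatM, h₁, h₂]
  | all φ ih => simp only [Formula.elimAll, Formula.neg, SatM, ih, imp_false, not_exists, not_and,
      not_not]
  | ex φ ih => simp only [Formula.elimAll, SatM, ih]

/-- At length `n + 1` the generated family is the generating set itself. -/
theorem Adequate.mem_witnessIndices {M : IndStructure L I A} {ll : LLRelation I}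
    {T : Set (Sentence L)} (hT : M.Adequate ll T) {n : ℕ} {ψ : Formula L (n + 1)}
    (hψ : (⟨n, .ex ψ⟩ : Σ k, Formula L k) ∈ hat T) {C : Fin n → I} {i : I}
    (hi : extend C i ∈ ll.ctx (n + 1)) {a : Fin n → A} (ha : a ∈ M.prod C) :
    i ∈ M.witnessIndices ψ C a := by
  obtain ⟨D, hD, h⟩ := hT (n + 1) hi n ψ hψ
  obtain rfl : extend C i = D := funext fun k => h k k.2 k.2
  simp only [extend, Set.mem_ofPred_eq, Fin.init_snoc, Fin.snoc_last] at hD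
  exact hD a ha

/-- The reflection principle: for an adequate `≪`-relation the interpretations `⊨_≪` and `⊨_m`
agree. -/
theorem Adequate.sat_iff_satM {M : IndStructure L I A} {ll : LLRelation I} {T : Set (Sentence L)}
    (hT : M.Adequate ll T) {n : ℕ} (φ : Formula L n) (hφ : φ.elimAll.subformulas ⊆ hat T)
    (C : Fin n → I) (hC : M.Declared ll φ C) (a : Fin n → A) (ha : a ∈ M.prod C) :
    M.Sat ll φ C a ↔ M.SatM φ C a := by
  induction φ with
  | bot => rfl
  | rel => rfl
  | imp φ ψ h₁ h₂ =>
    simp only [Formula.elimAll, Formula.subformulas, Set.union_subset_iff] at hφ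
    exact imp_congr (h₁ hφ.2.1 C hC.1 a ha) (h₂ hφ.2.2 C hC.2 a ha)
  | and φ ψ h₁ h₂ =>
    simp only [Formula.elimAll, Formula.subformulas, Set.union_subset_iff] at hφ
    exact and_congr (h₁ hφ.2.1 C hC.1 a ha) (h₂ hφ.2.2 C hC.2 a ha)
  | or φ ψ h₁ h₂ =>
    simp only [Formula.elimAll, Formula.subformulas, Set.union_subset_iff] at hφ
    exact or_congr (h₁ hφ.2.1 C hC.1 a ha) (h₂ hφ.2.2 C hC.2 a ha)
  | all φ ih =>
    simp only [Formula.elimAll, Formula.neg, Formula.subformulas, Set.union_subset_iff,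
      Set.singleton_subset_iff] at hφ
    constructor
    · rintro ⟨i, hi, hd, h⟩ j b hb
      by_contra hn
      -- Adequacy is applied to `∃ x ¬φ`, which is in the hat: a counterexample at any stage `j`
      -- forces one in `M_i`.
      have hw := hT.mem_witnessIndices hφ.2.1.1 hi ha
      simp only [witnessIndices, SatM, satM_elimAll, Set.mem_ofPred_eq] at hw
      obtain ⟨c, hc, hcn⟩ := hw ⟨j, b, hb, hn⟩
      exact hcn ((ih hφ.2.1.2.2.1 _ hd _ (M.extend_mem_prod ha hc)).1 (h c hc))
    · intro h
      obtain ⟨i, hi, hd⟩ := hC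
      exact ⟨i, hi, hd, fun b hb =>
        (ih hφ.2.1.2.2.1 _ hd _ (M.extend_mem_prod ha hb)).2 (h i b hb)⟩
  | ex φ ih =>
    simp only [Formula.elimAll, Formula.subformulas, Set.union_subset_iff,
      Set.singleton_subset_iff] at hφ
    constructor
    · intro h
      obtain ⟨i, hi, hd⟩ := hC
      obtain ⟨b, hb, hs⟩ := h i hi hd
      exact ⟨i, b, hb, (ih hφ.2 _ hd _ (M.extend_mem_prod ha hb)).1 hs⟩
    · rintro ⟨j, b, hb, h⟩ i hi hd
      have hw := hT.mem_witnessIndices hφ.1 hi ha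
      simp only [witnessIndices, satM_elimAll, Set.mem_ofPred_eq] at hw
      obtain ⟨c, hc, hs⟩ := hw ⟨j, b, hb, h⟩
      exact ⟨c, hc, (ih hφ.2 _ hd _ (M.extend_mem_prod ha hc)).2 hs⟩

theorem finite_hat {T : Set (Sentence L)} (hT : T.Finite) : (hat T).Finite := by
  refine (hT.biUnion fun φ _ => φ.elimAll.finite_subformulas).subset ?_
  rintro χ ⟨φ, hφ, h⟩
  exact Set.mem_biUnion hφ h

/-- A witness found at stage `j` persists at all later stages, because truth in the limit does not
depend on the context; without any witness the condition is vacuous. -/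
theorem eventually_mem_witnessIndices [IsDirectedOrder I] [Nonempty I] {n : ℕ}
    (ψ : Formula L (n + 1)) (C : Fin n → I) (a : Fin n → A) (ha : a ∈ M.prod C) :
    ∀ᶠ i in Filter.atTop, i ∈ M.witnessIndices ψ C a := by
  by_cases h : ∃ j, ∃ b ∈ M.carrier j, M.SatM ψ (extend C j) (extend a b)
  · obtain ⟨j, b, hb, h⟩ := h
    filter_upwards [Filter.eventually_ge_atTop j] with i hi _
    have hb' := M.carrier_mono hi hb
    refine ⟨b, hb', ?_⟩
    rw [satM_iff_realize _ _ _ _ (M.extend_mem_prod ha hb')]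
    rwa [satM_iff_realize _ _ _ _ (M.extend_mem_prod ha hb)] at h
  · exact .of_forall fun i hi => (h hi).elim

/-- For a finite set of sentences there is an adequate indefinitely large `≪`-relation. -/
theorem exists_adequate [IsDirectedOrder I] [Nonempty I] {T : Set (Sentence L)} (hT : T.Finite) :
    ∃ ll : LLRelation I, M.Adequate ll T ∧ ll.IsIndefinitelyLarge ∧
      (∀ n, ∀ C ∈ ll.ctx n, ∃ i, extend C i ∈ ll.ctx (n + 1)) ∧ ![] ∈ ll.ctx 0 := by
  let H : ∀ n : ℕ, Set (Fin (n + 1) → I) := fun n =>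
    {D | ∀ ψ : Formula L (n + 1), (⟨n, .ex ψ⟩ : Σ k, Formula L k) ∈ hat T →
      ∀ a ∈ M.prod (Fin.init D : Fin n → I), D (Fin.last n) ∈ M.witnessIndices ψ (Fin.init D) a}
  have hH : ∀ (n : ℕ) (C : Fin n → I), ∃ i₀ : I, ∀ i, i₀ ≤ i → extend C i ∈ H n := by
    intro n C
    have hfin : {ψ : Formula L (n + 1) | (⟨n, .ex ψ⟩ : Σ k, Formula L k) ∈ hat T}.Finite := by
      refine (finite_hat hT).preimage (Function.Injective.injOn ?_)
      intro ψ χ h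
      cases h
      rfl
    -- Finiteness of `T` and of `M_C` is used here: finitely many eventual conditions hold
    -- eventually together.
    have := (Filter.eventually_all_finite hfin).2 fun ψ _ =>
      (Filter.eventually_all_finite (M.finite_prod C)).2 fun a ha =>
        M.eventually_mem_witnessIndices ψ C a ha
    obtain ⟨i₀, hi₀⟩ := Filter.eventually_atTop.1 this
    refine ⟨i₀, fun i hi ψ hψ => ?_⟩
    simpa only [extend, Fin.init_snoc, Fin.snoc_last] using hi₀ i hi ψ hψ
  refine ⟨.hereditary H, fun m C hC n ψ hψ => ?_, LLRelation.isIndefinitelyLarge_hereditary hH,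
    fun n C hC => ?_, trivial⟩
  · obtain ⟨D, hD, h⟩ := hereditaryContexts_subset_generated hH n m hC
    exact ⟨D, hD ψ hψ, h⟩
  · obtain ⟨i, hi⟩ := hH n C
    exact ⟨i, extend_mem_hereditaryContexts.2 ⟨hC, hi i le_rfl⟩⟩

/-- With a full signature, `C ∘ t` itself serves as the assignment of an atom, and quantifiers only
need every context to have a prolongation. -/
theorem declared_of_full {ll : LLRelation I} (hM : ∀ (m : ℕ) (R : L.Relations m), M.sig R = Set.univ)
    (hll : ∀ n, ∀ C ∈ ll.ctx n, ∃ i, extend C i ∈ ll.ctx (n + 1)) {n : ℕ} (φ : Formula L n)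
    (C : Fin n → I) (hC : C ∈ ll.ctx n) : M.Declared ll φ C := by
  induction φ with
  | bot => exact hC
  | rel R t => exact ⟨hC, fun k => C (t k), by rw [hM]; trivial, fun _ => le_rfl⟩
  | imp φ ψ h₁ h₂ => exact ⟨h₁ C hC, h₂ C hC⟩
  | and φ ψ h₁ h₂ => exact ⟨h₁ C hC, h₂ C hC⟩
  | or φ ψ h₁ h₂ => exact ⟨h₁ C hC, h₂ C hC⟩
  | all φ ih => exact (hll _ C hC).imp fun i hi => ⟨hi, ih _ hi⟩
  | ex φ ih => exact (hll _ C hC).imp fun i hi => ⟨hi, ih _ hi⟩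

end IndStructure

/-! ### Soundness, countermodels and the equivalences -/

section Models

variable {L : FirstOrder.Language.{u, v}}

theorem IndModel.IsModelFor.satisfies_iff {M : IndModel.{u, v, w, w'} L} {T : Set (Sentence L)}
    (hM : M.IsModelFor T) {φ : Sentence L} (hφ : φ ∈ T) :
    M.Satisfies φ ↔ φ.Realize M.str.limit M.str.limitRel ![] := by
  have hprod : ![] ∈ M.str.prod (![] : Fin 0 → M.Idx) := fun k => k.elim0
  exact (hM.1.sat_iff_satM φ (fun χ hχ => ⟨φ, hφ, hχ⟩) ![] (hM.2 φ hφ) ![] hprod).trans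
    (M.str.satM_iff_realize φ ![] ![] hprod)

theorem Derives.satisfies {M : IndModel.{u, v, w, w'} L} {T Γ : Set (Sentence L)}
    {φ : Sentence L} (h : Derives Γ φ) (hM : M.IsModelFor T) (hφ : φ ∈ T) (hΓ : Γ ⊆ T)
    (hs : ∀ ψ ∈ Γ, M.Satisfies ψ) : M.Satisfies φ := by
  obtain ⟨i, b, hb⟩ := M.str.carrier_nonempty
  exact (hM.satisfies_iff hφ).2 (h.realize (D := M.str.limit) ⟨b, i, hb⟩ ![] (fun k => k.elim0)
    fun γ hγ => (hM.satisfies_iff (hΓ hγ)).1 (hs γ hγ))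

/-- The structure on the natural numbers with the stages `{0, …, i}` and full refined signature. -/
def IndStructure.ofNat (r : ∀ m : ℕ, L.Relations m → (Fin m → ℕ) → Prop) :
    IndStructure L (ULift.{w} ℕ) (ULift.{w'} ℕ) where
  carrier i := {a | a.down ≤ i.down}
  carrier_finite i := (Set.finite_Iic i.down).preimage ULift.down_injective.injOn
  carrier_mono {_ j} h a ha := show a.down ≤ j.down from le_trans ha h
  carrier_nonempty := ⟨⟨0⟩, ⟨0⟩, le_refl 0⟩
  sig _ := Set.univ
  sig_large {n} _ := isLarge_univ n
  rel R C := {a | (∀ k, (a k).down ≤ (C k).down) ∧ r _ R fun k => (a k).down}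
  rel_subset _ _ _ _ ha := ha.1
  rel_compatible _ _ _ _ _ _ h h' := ⟨fun ha => ⟨h', ha.2⟩, fun ha => ⟨h, ha.2⟩⟩

theorem IndStructure.limit_ofNat (r : ∀ m : ℕ, L.Relations m → (Fin m → ℕ) → Prop) :
    (ofNat.{u, v, w, w'} r).limit = Set.univ :=
  Set.eq_univ_of_forall fun a => ⟨⟨a.down⟩, le_refl a.down⟩

theorem IndStructure.limitRel_ofNat (r : ∀ m : ℕ, L.Relations m → (Fin m → ℕ) → Prop) :
    (ofNat.{u, v, w, w'} r).limitRel = fun m R a => r m R fun k => (a k).down := by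
  funext m R a
  exact propext ⟨fun ⟨_, _, h⟩ => h.2,
    -- The tuple, read as a context, is the least one whose stages contain it.
    fun h => ⟨fun k => ⟨(a k).down⟩, trivial, fun k => le_refl (a k).down, h⟩⟩

/-- The underivable sentences have countermodels with full refined signature and indefinitely large
`≪`-relation. -/
theorem exists_fullLarge_countermodel {T Γ : Set (Sentence L)} (hT : T.Finite) (hΓ : Γ ⊆ T)
    {φ : Sentence L} (hφ : φ ∈ T) (h : ¬ Derives Γ φ) :
    ∃ M ∈ fullLargeIndModels.{u, v, w, w'} L, M.IsModelFor T ∧ (∀ ψ ∈ Γ, M.Satisfies ψ) ∧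
      ¬ M.Satisfies φ := by
  obtain ⟨r, hr, hn⟩ := exists_realize_of_not_derives (hT.subset hΓ).countable h
  obtain ⟨ll, hll, hlarge, hext, h₀⟩ :=
    (IndStructure.ofNat.{u, v, w, w'} r).exists_adequate hT
  let M : IndModel.{u, v, w, w'} L := ⟨_, _, .ofNat r, ll⟩
  have hM : M.IsModelFor T :=
    ⟨hll, fun ψ _ => (IndStructure.ofNat r).declared_of_full (fun _ _ => rfl) hext ψ ![] h₀⟩
  have hsat : ∀ ψ ∈ T, M.Satisfies ψ ↔ ψ.Realize Set.univ r ![] := by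
    intro ψ hψ
    rw [hM.satisfies_iff hψ]
    change ψ.Realize (IndStructure.ofNat r).limit (IndStructure.ofNat r).limitRel ![] ↔ _
    rw [IndStructure.limit_ofNat, IndStructure.limitRel_ofNat,
      Formula.realize_comp ULift.down ULift.down_surjective]
    congr!
  exact ⟨M, ⟨fun _ _ => rfl, hlarge⟩, hM, fun ψ hψ => (hsat ψ (hΓ hψ)).2 (hr ψ hψ),
    fun hs => hn ((hsat φ hφ).1 hs)⟩

theorem derives_iff_entails {K : Set (IndModel.{u, v, w, w'} L)} (hK : fullLargeIndModels L ⊆ K)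
    {Γ : Set (Sentence L)} (hΓ : Γ.Finite) (φ : Sentence L) : Derives Γ φ ↔ Entails K Γ φ := by
  refine ⟨fun h M _ hM hs => h.satisfies hM (Set.mem_insert _ _) (Set.subset_insert _ _) hs,
    fun h => ?_⟩
  by_contra hn
  obtain ⟨M, hMK, hM, hs, hns⟩ := exists_fullLarge_countermodel (hΓ.insert φ)
    (Set.subset_insert _ _) (Set.mem_insert _ _) hn
  exact hns (h M (hK hMK) hM hs)

theorem derives_iff_valid {K : Set (IndModel.{u, v, w, w'} L)} (hK : fullLargeIndModels L ⊆ K)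
    {T : Set (Sentence L)} (hT : T.Finite) : (∀ φ ∈ T, Derives ∅ φ) ↔ Valid K T := by
  refine ⟨fun h M _ hM φ hφ => (h φ hφ).satisfies hM hφ (Set.empty_subset _) (by simp),
    fun h φ hφ => ?_⟩
  by_contra hn
  obtain ⟨M, hMK, hM, -, hns⟩ := exists_fullLarge_countermodel hT (Set.empty_subset _) hφ hn
  exact hns (h M (hK hMK) hM φ hφ)

end Models

end PotInf

/-- Soundness and completeness of the interpretation with reflection principle, for the class
`K = Set.univ` of all indefinitely extensible models, and likewise for every smaller class `K` that
still contains all models with full signature and indefinitely large `≪`-relation. -/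
theorem mainTheorem3 (L : FirstOrder.Language.{u, v}) [L.IsRelational]
    (K : Set (PotInf.IndModel.{u, v, w, w'} L))
    (hK : PotInf.fullLargeIndModels L ⊆ K) :
    (∀ T : Set (PotInf.Sentence L), T.Finite →
      ((∀ φ ∈ T, PotInf.Derives ∅ φ) ↔ PotInf.Valid K T)) ∧
    (∀ (Γ : Set (PotInf.Sentence L)) (φ : PotInf.Sentence L), Γ.Finite →
      (PotInf.Derives Γ φ ↔ PotInf.Entails K Γ φ)) ∧
    (∀ (Γ : Set (PotInf.Sentence L)) (φ : PotInf.Sentence L),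
      PotInf.Derives Γ φ ↔ ∃ Γ₀ : Set (PotInf.Sentence L), Γ₀ ⊆ Γ ∧ Γ₀.Finite ∧
        ∀ Γ₁ : Set (PotInf.Sentence L), Γ₀ ⊆ Γ₁ → Γ₁ ⊆ Γ → Γ₁.Finite →
          PotInf.Entails K Γ₁ φ) := by
  refine ⟨fun T hT => PotInf.derives_iff_valid hK hT,
    fun Γ φ hΓ => PotInf.derives_iff_entails hK hΓ φ, fun Γ φ => ⟨fun h => ?_, ?_⟩⟩
  · obtain ⟨Γ₀, h₀, hf, hd⟩ := h.exists_finite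
    exact ⟨Γ₀, h₀, hf, fun Γ₁ h₁ _ hf₁ => (PotInf.derives_iff_entails hK hf₁ φ).1 (hd.mono h₁)⟩
  · rintro ⟨Γ₀, h₀, hf, h⟩
    -- The smallest admissible choice `Γ₁ = Γ₀` suffices.
    exact ((PotInf.derives_iff_entails hK hf φ).2 (h Γ₀ subset_rfl h₀ hf)).mono h₀
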